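/- Let $n\ge 1$. A naive EGK datum of length $n$ is an element $H=(a_1,\ldots,a_n;\varepsilon_1,\ldots,\varepsilon_n)$ of $\mathbb{Z}_{\ge 0}^n\times\{0,1,-1\}^n$ such that - (N1) $a_1\le\cdots\le a_n$; - (N2) for even $i$, $\varepsilon_i\ne 0$ if and only if $a_1+\cdots+a_i$ is even; - (N3) for odd $i$, $\varepsilon_i\neq 0$; - (N4) $\varepsilon_1=1$; - (N5) for odd $i\ge 3$ with $a_1+\cdots+a_{i-1}$ even, $\varepsilon_i=\varepsilon_{i-1}^{a_i+a_{i-1}}\varepsilon_{i-2}$. Put $\mathfrak e_i=a_1+\cdots+a_i$ if $i$ is odd and $\mathfrak e_i=2\lfloor (a_1+\cdots+a_i)/2\rfloor$ if $i$ is even. For integers $e,\widetilde e$ and a number $\xi$ let $$C_i(e,\widetilde e,\xi;Y,X)=\frac{Y^{\widetilde e/2}X^{-(e-\widetilde e)/2-1}(1-\xi Y^{-1}X)}{X^{-1}-X}\ \ (i\text{ even}),\qquad C_i(e,\widetilde e,\xi;Y,X)=\frac{Y^{\widetilde e/2}X^{-(e-\widetilde e)/2}}{1-\xi X}\ \ (i\text{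 odd}).$$ Define the rational function $\mathcal F(H;Y,X)$ in $X^{1/2}$ and $Y^{1/2}$ recursively by $$\mathcal F(H;Y,X)=X^{-a_1/2}+X^{-a_1/2+1}+\cdots+X^{a_1/2-1}+X^{a_1/2}$$ if $n=1$, and, if $n>1$, with $H'=(a_1,\ldots,a_{n-1};\varepsilon_1,\ldots,\varepsilon_{n-1})$, by $$\mathcal F(H;Y,X)=C_n(\mathfrak e_n,\mathfrak e_{n-1},\xi;Y,X)\,\mathcal F(H';Y,YX)+\zeta\, C_n(\mathfrak e_n,\mathfrak e_{n-1},\xi;Y,X^{-1})\,\mathcal F(H';Y,YX^{-1}),$$ where $(\xi,\zeta)=(\varepsilon_n,1)$ if $n$ is even and $(\xi,\zeta)=(\varepsilon_{n-1},\varepsilon_n)$ if $n$ is odd. Then, for every naive EGK datum $H$ of length $n$, $\mathcal F(H;Y,X)$ is a Laurent polynomial in $X^{1/2}$ with coefficients in $\mathbb{Z}[Y,Y^{-1}]$. -/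

import Mathlib

namespace NaiveEGK

open scoped BigOperators

/-- The conditions defining a naive EGK datum `(a_1, …, a_n; ε_1, …, ε_n)`.  The indices of the
tuples start at `0`, so `a i` and `ε i` are the entries usually numbered `i + 1`; in particular an
odd (even) position in the usual numbering is an even (odd) value of `i : Fin n`.  `SignType` is
the set `{0, 1, -1}` with its multiplication. -/
structure IsNaiveEGK {n : ℕ} (a : Fin n → ℕ) (ε : Fin n → SignType) : Prop where
  /-- `a_1 ≤ ⋯ ≤ a_n` -/
  mono : Monotone a
  /-- at an even position `i`, `ε_i ≠ 0` if and only if `a_1 + ⋯ + a_i` is even -/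
  even_pos : ∀ i : Fin n, Odd (i : ℕ) → (ε i ≠ 0 ↔ Even (∑ j ∈ Finset.Iic i, a j))
  /-- at an odd position `i`, `ε_i ≠ 0` -/
  odd_pos : ∀ i : Fin n, Even (i : ℕ) → ε i ≠ 0
  /-- `ε_1 = 1` -/
  first : ∀ h : 0 < n, ε ⟨0, h⟩ = 1
  /-- at an odd position `i ≥ 3` with `a_1 + ⋯ + a_{i-1}` even,
  `ε_i = ε_{i-1} ^ (a_i + a_{i-1}) * ε_{i-2}`; here the position `i` is written `k + 3` -/
  odd_step : ∀ (k : ℕ) (h : k + 2 < n), Even k →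
    Even (∑ j ∈ Finset.Iic (⟨k + 1, by omega⟩ : Fin n), a j) →
    ε ⟨k + 2, h⟩ = ε ⟨k + 1, by omega⟩ ^ (a ⟨k + 2, h⟩ + a ⟨k + 1, by omega⟩) * ε ⟨k, by omega⟩

/-- The integer `𝔢_n` of a sequence `(a_1, …, a_n)`: the sum `a_1 + ⋯ + a_n` if `n` is odd, and
twice the integral part of half that sum if `n` is even (so `0` if `n = 0`).  The integer `𝔢_i`
for `i ≤ n` is that of the truncated sequence `(a_1, …, a_i)`. -/
def frakE {n : ℕ} (a : Fin n → ℕ) : ℕ :=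
  if Odd n then ∑ i, a i else 2 * ((∑ i, a i) / 2)

noncomputable section

/-- The field `ℚ(Y^{1/2})`, with `Y^{1/2}` as its indeterminate. -/
abbrev BaseField : Type := RatFunc ℚ

/-- The field `ℚ(Y^{1/2}, X^{1/2})` of rational functions in `X^{1/2}` and `Y^{1/2}`, built as the
rational functions in the indeterminate `X^{1/2}` over `ℚ(Y^{1/2})`. -/
abbrev FunctionField : Type := RatFunc BaseField

/-- The element `Y^{1/2}`. -/
def sqrtY : FunctionField := RatFunc.C RatFunc.X

/-- The element `X^{1/2}`. -/
def sqrtX : FunctionField := RatFunc.X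

theorem sqrtY_ne_zero : sqrtY ≠ 0 := by
  unfold sqrtY
  rw [Ne, map_eq_zero]
  exact RatFunc.X_ne_zero

theorem sqrtX_ne_zero : sqrtX ≠ 0 := RatFunc.X_ne_zero

theorem sqrtX_ne_C (c : BaseField) : sqrtX ≠ RatFunc.C c := by
  intro h
  have h2 : (algebraMap (Polynomial BaseField) FunctionField) Polynomial.X
      = (algebraMap (Polynomial BaseField) FunctionField) (Polynomial.C c) := by
    rw [RatFunc.algebraMap_X, RatFunc.algebraMap_C]; exact h
  exact Polynomial.X_ne_C c (RatFunc.algebraMap_injective BaseField h2)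

theorem transcendental_sqrtY_mul_sqrtX : Transcendental BaseField (sqrtY * sqrtX) := by
  apply RatFunc.transcendental_of_ne_C
  rintro ⟨c, hc⟩
  apply sqrtX_ne_C (RatFunc.X⁻¹ * c)
  rw [map_mul, map_inv₀, ← hc]
  exact (inv_mul_cancel_left₀ sqrtY_ne_zero sqrtX).symm

theorem transcendental_sqrtY_mul_sqrtX_inv : Transcendental BaseField (sqrtY * sqrtX⁻¹) := by
  apply RatFunc.transcendental_of_ne_C
  rintro ⟨c, hc⟩
  apply sqrtX_ne_C (RatFunc.X * c⁻¹)
  rw [map_mul, map_inv₀, ← hc, mul_inv, inv_inv]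
  exact (mul_inv_cancel_left₀ sqrtY_ne_zero sqrtX).symm

/-- For `u` transcendental over `ℚ(Y^{1/2})`, the substitution of `u` for `X^{1/2}` in rational
functions, as a homomorphism of fields over `ℚ(Y^{1/2})`. -/
def subst (u : FunctionField) (hu : Transcendental BaseField u) :
    FunctionField →ₐ[BaseField] FunctionField :=
  RatFunc.liftAlgHom (Polynomial.aeval u)
    (nonZeroDivisors_le_comap_nonZeroDivisors_of_injective _
      (transcendental_iff_injective.mp hu))

theorem subst_sqrtX (u : FunctionField) (hu : Transcendental BaseField u) :
    subst u hu sqrtX = u := by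
  have h : sqrtX = algebraMap (Polynomial BaseField) FunctionField Polynomial.X :=
    RatFunc.algebraMap_X.symm
  rw [h]
  have h1 := RatFunc.liftAlgHom_apply_div (Polynomial.aeval u)
    (nonZeroDivisors_le_comap_nonZeroDivisors_of_injective _
      (transcendental_iff_injective.mp hu)) (Polynomial.X : Polynomial BaseField) 1
  simpa [subst] using h1

theorem subst_sqrtY (u : FunctionField) (hu : Transcendental BaseField u) :
    subst u hu sqrtY = sqrtY :=
  (subst u hu).commutes RatFunc.X

/-- The substitution `F(Y, X) ↦ F(Y, Y X)`, that is, `X^{1/2} ↦ Y^{1/2} X^{1/2}`. -/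
def substYX : FunctionField →ₐ[BaseField] FunctionField :=
  subst (sqrtY * sqrtX) transcendental_sqrtY_mul_sqrtX

/-- The substitution `F(Y, X) ↦ F(Y, Y X⁻¹)`, that is, `X^{1/2} ↦ Y^{1/2} X^{-1/2}`. -/
def substYXInv : FunctionField →ₐ[BaseField] FunctionField :=
  subst (sqrtY * sqrtX⁻¹) transcendental_sqrtY_mul_sqrtX_inv

/-- `C(e, e', ξ; Y, X) = Y^{e'/2} X^{-(e-e')/2-1} (1 - ξ Y⁻¹ X) / (X⁻¹ - X)`, as a function of
`x = X^{1/2}`. -/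
def coefC (e e' ξ : ℤ) (x : FunctionField) : FunctionField :=
  sqrtY ^ e' * x ^ (-(e - e') - 2) * (1 - (ξ : FunctionField) * (sqrtY ^ 2)⁻¹ * x ^ 2) /
    ((x ^ 2)⁻¹ - x ^ 2)

/-- `D(e, e', ξ; Y, X) = Y^{e'/2} X^{-(e-e')/2} / (1 - ξ X)`, as a function of `x = X^{1/2}`. -/
def coefD (e e' ξ : ℤ) (x : FunctionField) : FunctionField :=
  sqrtY ^ e' * x ^ (-(e - e')) / (1 - (ξ : FunctionField) * x ^ 2)

/-- `C_i`, which is `C` for even `i` and `D` for odd `i`. -/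
def coef (i : ℕ) (e e' ξ : ℤ) (x : FunctionField) : FunctionField :=
  if Even i then coefC e e' ξ x else coefD e e' ξ x

/-- The rational function `𝓕(H; Y, X)` of `H = (a_1, …, a_n; ε_1, …, ε_n)`, by recursion on `n`.
For `n = 1` it is `X^{-a_1/2} + X^{-a_1/2+1} + ⋯ + X^{a_1/2}`.  The truncation `H'` of `H` drops
the last entries `a_n` and `ε_n`.  (The value at `n = 0` is a placeholder, which the other cases
do not use.) -/
def calF : (n : ℕ) → (Fin n → ℕ) → (Fin n → SignType) → FunctionField
  | 0, _, _ => 1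
  | 1, a, _ => ∑ k ∈ Finset.range (a 0 + 1), sqrtX ^ (2 * (k : ℤ) - (a 0 : ℤ))
  | m + 2, a, ε =>
    let a' : Fin (m + 1) → ℕ := Fin.init a
    let ε' : Fin (m + 1) → SignType := Fin.init ε
    let ξ : ℤ := if Even (m + 2) then (ε (Fin.last (m + 1)) : ℤ) else (ε' (Fin.last m) : ℤ)
    let ζ : ℤ := if Even (m + 2) then 1 else (ε (Fin.last (m + 1)) : ℤ)
    coef (m + 2) (frakE a) (frakE a') ξ sqrtX * substYX (calF (m + 1) a' ε') +
      (ζ : FunctionField) * coef (m + 2) (frakE a) (frakE a') ξ sqrtX⁻¹ *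
        substYXInv (calF (m + 1) a' ε')

/-- The ring homomorphism from Laurent polynomials in an indeterminate `T` over `ℤ[Y, Y⁻¹]` (the
inner Laurent polynomial ring) to `ℚ(Y^{1/2}, X^{1/2})` that sends `Y` to `Y` and `T` to
`X^{1/2}`. -/
def ofLaurent : LaurentPolynomial (LaurentPolynomial ℤ) →+* FunctionField :=
  LaurentPolynomial.eval₂
    (LaurentPolynomial.eval₂ (Int.castRingHom FunctionField)
      (Units.mk0 (sqrtY ^ 2) (pow_ne_zero 2 sqrtY_ne_zero)))
    (Units.mk0 sqrtX sqrtX_ne_zero)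

end

end NaiveEGK

/-!
Passing from an odd length to an even one, `𝓕` becomes `(G(X) - G(X⁻¹)) / (X⁻¹ - X)` for a Laurent
polynomial `G`, and `X⁻¹ - X` always divides `G(X) - G(X⁻¹)` (`dvd_sub_invert`). Passing from an
even length `n - 1` to the odd length `n`, the only possible pole is at `X = ξ` with
`ξ = ε_{n-1} = ±1`, and its residue is a multiple of `(1 - ε_n ξ ^ a_n) P(ξ Y)`, where `P` is `𝓕` at
length `n - 1`. By the relation (N5) the first factor is nonzero only if
`ξ ^ a_{n-1} ≠ ε_{n-2}`, and then `P(ξ Y) = 0`. Indeed, in the recursion for `P` the first summand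
vanishes at `X = ξ Y` because of its factor `1 - ξ Y⁻¹ X`, and the second is a multiple of the value
at `ξ` of the function at length `n - 2`; that value vanishes because of the functional equation
`𝓕(H; Y, X⁻¹) = ε_{n-2} 𝓕(H; Y, X)`, which holds at odd length since the recursion is symmetric up
to the sign `ζ`.

The induction therefore goes by steps of two, with `OddShape` (which contains the functional
equation) at odd length and `EvenShape` (which contains the vanishing at `ξ Y`) in between.
Half-integral powers are kept out of the algebra: at odd length `𝓕` is `X^{-e/2}`,
`e = a_1 + ⋯ + a_n`, times a Laurent polynomial in `X`, and at even length it is a Laurent polynomial in `X`. All divisions then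
take place in `ℤ[Y, Y⁻¹][X, X⁻¹]`, which `ofLaurentX` maps to the function field.
-/

open LaurentPolynomial

namespace NaiveEGK

/-! ### Substitution and divisibility in Laurent polynomial rings -/

section Laurent

variable {A : Type*} [CommRing A]

theorem laurent_ringHom_ext {S : Type*} [CommSemiring S] {f g : A[T;T⁻¹] →+* S}
    (hC : ∀ a, f (C a) = g (C a)) (hT : f (T 1) = g (T 1)) : f = g := by
  apply IsLocalization.ringHom_ext (Submonoid.powers (Polynomial.X : Polynomial A))
  apply Polynomial.ringHom_ext
  · intro a
    simpa using hC a
  · simpa using hT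

/-- The indeterminate of a Laurent polynomial ring, as a unit. -/
noncomputable def unitT (A : Type*) [CommRing A] : (A[T;T⁻¹])ˣ :=
  ⟨T 1, T (-1), by rw [← T_add]; rfl, by rw [← T_add]; rfl⟩

theorem unitT_val : (unitT A : A[T;T⁻¹]) = T 1 := rfl

theorem unitT_zpow (n : ℤ) : ((unitT A ^ n : (A[T;T⁻¹])ˣ) : A[T;T⁻¹]) = T n := by
  have h := eval₂_T (C : A →+* A[T;T⁻¹]) (unitT A) n
  have hid : eval₂ (C : A →+* A[T;T⁻¹]) (unitT A) = RingHom.id _ := by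
    apply laurent_ringHom_ext
    · intro a; simp
    · simp [unitT]
  rw [← h, hid, RingHom.id_apply]

/-- The value of a Laurent polynomial at a unit of its coefficient ring. -/
noncomputable def evalUnit (u : Aˣ) : A[T;T⁻¹] →+* A := eval₂ (RingHom.id A) u

/-- The substitution of a unit `u` of the Laurent polynomial ring for the indeterminate. -/
noncomputable def substUnit (u : (A[T;T⁻¹])ˣ) : A[T;T⁻¹] →+* A[T;T⁻¹] := eval₂ C u

theorem units_sub_dvd_zpow_sub_zpow (u v : Aˣ) (n : ℤ) :
    (u : A) - v ∣ ((u ^ n : Aˣ) : A) - ((v ^ n : Aˣ) : A) := by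
  obtain ⟨k, rfl | rfl⟩ := n.eq_nat_or_neg
  · simpa using sub_dvd_pow_sub_pow (u : A) v k
  · obtain ⟨c, hc⟩ := sub_dvd_pow_sub_pow (u : A) v k
    refine ⟨-(((u ^ (-k : ℤ) : Aˣ) : A) * ((v ^ (-k : ℤ) : Aˣ) : A)) * c, ?_⟩
    have hu : ((u ^ (-k : ℤ) : Aˣ) : A) * (u : A) ^ k = 1 := by
      rw [zpow_neg, zpow_natCast, ← Units.val_pow_eq_pow_val, Units.inv_mul]
    have hv : ((v ^ (-k : ℤ) : Aˣ) : A) * (v : A) ^ k = 1 := by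
      rw [zpow_neg, zpow_natCast, ← Units.val_pow_eq_pow_val, Units.inv_mul]
    linear_combination -((u ^ (-k : ℤ) : Aˣ) : A) * ((v ^ (-k : ℤ) : Aˣ) : A) * hc
      + ((v ^ (-k : ℤ) : Aˣ) : A) * hu - ((u ^ (-k : ℤ) : Aˣ) : A) * hv

/-- The factor theorem for Laurent polynomials. -/
theorem T_sub_C_dvd (u : Aˣ) (P : A[T;T⁻¹]) : T 1 - C (u : A) ∣ P - C (evalUnit u P) := by
  induction P using LaurentPolynomial.induction_on' with
  | add p q hp hq =>
    have : p + q - C (evalUnit u (p + q)) = (p - C (evalUnit u p)) + (q - C (evalUnit u q)) := by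
      rw [map_add, map_add]; ring
    rw [this]
    exact dvd_add hp hq
  | C_mul_T n a =>
    have h := units_sub_dvd_zpow_sub_zpow (unitT A) (Units.map (C : A →+* A[T;T⁻¹]) u) n
    rw [unitT_zpow, ← map_zpow, unitT_val] at h
    have e : (C a * T n : A[T;T⁻¹]) - C (evalUnit u (C a * T n))
        = C a * (T n - C ((u ^ n : Aˣ) : A)) := by
      simp [evalUnit, mul_sub]
    rw [e]
    exact Dvd.dvd.mul_left h _

theorem dvd_sub_invert (P : A[T;T⁻¹]) : T (-1) - T 1 ∣ P - invert P := by
  induction P using LaurentPolynomial.induction_on' with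
  | add p q hp hq =>
    rw [map_add, add_sub_add_comm]
    exact dvd_add hp hq
  | C_mul_T n a =>
    have h := units_sub_dvd_zpow_sub_zpow (unitT A ^ (-1 : ℤ)) (unitT A) n
    rw [← zpow_mul, unitT_zpow, unitT_zpow, unitT_zpow, neg_one_mul, unitT_val] at h
    have e : (C a * T n : A[T;T⁻¹]) - invert (C a * T n) = -C a * (T (-n) - T n) := by
      rw [map_mul, invert_C, invert_T]
      ring
    rw [e]
    exact Dvd.dvd.mul_left h _

end Laurent

/-! ### Laurent polynomials in `X` inside the function field -/

/-- `ℤ[Y, Y⁻¹]`. -/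
abbrev CoefRing : Type := ℤ[T;T⁻¹]

/-- `Y`, as a unit of the ring of Laurent polynomials in `X` over `ℤ[Y, Y⁻¹]`. -/
noncomputable def unitY : (CoefRing[T;T⁻¹])ˣ :=
  Units.map (C : CoefRing →+* CoefRing[T;T⁻¹]) (unitT ℤ)

/-- The substitution `X ↦ Y X`. -/
noncomputable def scale : CoefRing[T;T⁻¹] →+* CoefRing[T;T⁻¹] := substUnit (unitY * unitT _)

/-- The substitution `X ↦ Y X⁻¹`. -/
noncomputable def scaleInv : CoefRing[T;T⁻¹] →+* CoefRing[T;T⁻¹] := substUnit (unitY * (unitT _)⁻¹)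

/-- The embedding that sends the indeterminate to `X`, while `ofLaurent` sends it to `X^{1/2}`. -/
noncomputable def ofLaurentX : CoefRing[T;T⁻¹] →+* FunctionField :=
  ofLaurent.comp (substUnit (unitT _ ^ 2))

theorem invert_scale (Q : CoefRing[T;T⁻¹]) : invert (scale Q) = scaleInv Q := by
  have : (invert : _ ≃ₐ[CoefRing] _).toRingEquiv.toRingHom.comp scale = scaleInv := by
    apply laurent_ringHom_ext
    · intro a; simp [scale, scaleInv, substUnit]
    · simp [scale, scaleInv, substUnit, unitY, unitT]
  exact RingHom.congr_fun this Q

theorem invert_scaleInv (Q : CoefRing[T;T⁻¹]) : invert (scaleInv Q) = scale Q := by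
  rw [← invert_scale]
  exact involutive_invert _

@[simp] theorem ofLaurentX_T (n : ℤ) : ofLaurentX (T n) = sqrtX ^ (2 * n) := by
  have h : substUnit (unitT CoefRing ^ 2) (T n) = T (2 * n) := by
    rw [substUnit, eval₂_T, ← unitT_zpow, zpow_mul]; norm_cast
  simp [ofLaurentX, h, ofLaurent]

@[simp] theorem ofLaurentX_C_T (n : ℤ) : ofLaurentX (C (T n)) = sqrtY ^ (2 * n) := by
  simp [ofLaurentX, substUnit, ofLaurent, zpow_mul]

theorem map_ofLaurentX_C (f : FunctionField →+* FunctionField) (hf : f sqrtY = sqrtY)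
    (a : CoefRing) : f (ofLaurentX (C a)) = ofLaurentX (C a) := by
  have : (f.comp ofLaurentX).comp C = ofLaurentX.comp (C : CoefRing →+* _) := by
    apply laurent_ringHom_ext
    · intro n; simp
    · simp [hf]
  exact RingHom.congr_fun this a

theorem substYX_ofLaurentX (Q : CoefRing[T;T⁻¹]) :
    substYX (ofLaurentX Q) = ofLaurentX (scale Q) := by
  have hX : substYX sqrtX = sqrtY * sqrtX := subst_sqrtX _ _
  have : (substYX : FunctionField →+* FunctionField).comp ofLaurentX = ofLaurentX.comp scale := by
    apply laurent_ringHom_ext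
    · intro a
      have h1 : scale (C a) = C a := by simp [scale, substUnit]
      simpa [h1] using map_ofLaurentX_C (substYX : FunctionField →+* FunctionField)
        (subst_sqrtY _ transcendental_sqrtY_mul_sqrtX) a
    · have h1 : scale (T 1) = C (T 1) * T 1 := by simp [scale, substUnit, unitY, unitT]
      simp only [RingHom.comp_apply, h1, map_mul, ofLaurentX_T, ofLaurentX_C_T, RingHom.coe_coe,
        map_zpow₀, hX, mul_zpow]
  exact RingHom.congr_fun this Q

theorem substYXInv_ofLaurentX (Q : CoefRing[T;T⁻¹]) :
    substYXInv (ofLaurentX Q) = ofLaurentX (scaleInv Q) := by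
  have hX : substYXInv sqrtX = sqrtY * sqrtX⁻¹ := subst_sqrtX _ _
  have : (substYXInv : FunctionField →+* FunctionField).comp ofLaurentX
      = ofLaurentX.comp scaleInv := by
    apply laurent_ringHom_ext
    · intro a
      have h1 : scaleInv (C a) = C a := by simp [scaleInv, substUnit]
      simpa [h1] using map_ofLaurentX_C (substYXInv : FunctionField →+* FunctionField)
        (subst_sqrtY _ transcendental_sqrtY_mul_sqrtX_inv) a
    · have h1 : scaleInv (T 1) = C (T 1) * T (-1) := by
        simp [scaleInv, substUnit, unitY, unitT]
      simp only [RingHom.comp_apply, h1, map_mul, ofLaurentX_T, ofLaurentX_C_T, RingHom.coe_coe,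
        map_zpow₀, hX, mul_zpow, inv_zpow', mul_neg]
  exact RingHom.congr_fun this Q

theorem sqrtX_transcendental : Transcendental BaseField sqrtX :=
  RatFunc.transcendental_of_ne_C _ (by rintro ⟨c, hc⟩; exact sqrtX_ne_C c hc)

theorem inv_sq_sub_sq_ne_zero : (sqrtX ^ 2)⁻¹ - sqrtX ^ 2 ≠ 0 := by
  intro h
  have h4 : sqrtX ^ 4 - 1 = 0 := by
    have := sqrtX_ne_zero
    field_simp at h
    linear_combination -h
  have := transcendental_iff.mp sqrtX_transcendental (Polynomial.X ^ 4 - 1) (by simpa using h4)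
  exact Polynomial.X_pow_sub_C_ne_zero (R := BaseField) (n := 4) (by norm_num) 1
    (by simpa using this)

theorem one_sub_mul_sq_ne_zero (ξ : ℤ) : 1 - (ξ : FunctionField) * sqrtX ^ 2 ≠ 0 := by
  intro h
  have := transcendental_iff.mp sqrtX_transcendental
    (1 - (ξ : Polynomial BaseField) * Polynomial.X ^ 2) (by simpa using h)
  simpa using congrArg (Polynomial.eval 0) this

/-! ### Values at `ξ` and at `ξ Y` -/

/-- A sign `±1`, as a unit of `ℤ[Y, Y⁻¹]`. -/
noncomputable def signUnit (u : ℤˣ) : CoefRingˣ :=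
  Units.map (Int.castRingHom CoefRing).toMonoidHom u

theorem signUnit_zpow_val (u : ℤˣ) (n : ℤ) :
    ((signUnit u ^ n : CoefRingˣ) : CoefRing) = (((u ^ n : ℤˣ) : ℤ) : CoefRing) := by
  rw [signUnit, ← map_zpow]; rfl

theorem signUnit_inv (u : ℤˣ) : (signUnit u)⁻¹ = signUnit u := by
  rw [signUnit, ← map_inv, Int.units_inv_eq_self]

theorem evalUnit_T {A : Type*} [CommRing A] (v : Aˣ) (n : ℤ) :
    evalUnit v (T n) = ((v ^ n : Aˣ) : A) := by simp [evalUnit]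

theorem evalUnit_C {A : Type*} [CommRing A] (v : Aˣ) (a : A) : evalUnit v (C a) = a := by
  simp [evalUnit]

theorem evalUnit_invert {A : Type*} [CommRing A] (v : Aˣ) (Q : A[T;T⁻¹]) :
    evalUnit v (invert Q) = evalUnit v⁻¹ Q := by
  have : (evalUnit v).comp (invert : _ ≃ₐ[A] _).toRingEquiv.toRingHom = evalUnit v⁻¹ := by
    apply laurent_ringHom_ext
    · intro a; simp [evalUnit]
    · simp [evalUnit]
  exact RingHom.congr_fun this Q

theorem evalUnit_scale (v : CoefRingˣ) (Q : CoefRing[T;T⁻¹]) :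
    evalUnit v (scale Q) = evalUnit (unitT ℤ * v) Q := by
  have : (evalUnit v).comp scale = evalUnit (unitT ℤ * v) := by
    apply laurent_ringHom_ext
    · intro a; simp [evalUnit, scale, substUnit]
    · simp [evalUnit, scale, substUnit, unitY, unitT_val]
  exact RingHom.congr_fun this Q

theorem evalUnit_scaleInv (v : CoefRingˣ) (Q : CoefRing[T;T⁻¹]) :
    evalUnit v (scaleInv Q) = evalUnit (unitT ℤ * v⁻¹) Q := by
  rw [← invert_scale, evalUnit_invert, evalUnit_scale]

theorem one_sub_mul_T_ne_zero (ξ : ℤ) :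
    (1 : CoefRing[T;T⁻¹]) - (ξ : CoefRing[T;T⁻¹]) * T 1 ≠ 0 := by
  intro h
  apply one_sub_mul_sq_ne_zero ξ
  have := congrArg ofLaurentX h
  simpa using this

/-! ### The step from odd to even length -/

/-- The numerator of the first summand of `𝓕` in the step to an even length, where
`e = 2 * h`. -/
noncomputable def evenNumerator (h ξ : ℤ) (Q : CoefRing[T;T⁻¹]) : CoefRing[T;T⁻¹] :=
  T (-h - 1) * (1 - (ξ : CoefRing[T;T⁻¹]) * C (T (-1)) * T 1) * scale Q

theorem invert_evenNumerator (h ξ : ℤ) (Q : CoefRing[T;T⁻¹]) :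
    invert (evenNumerator h ξ Q) =
      T (h + 1) * (1 - (ξ : CoefRing[T;T⁻¹]) * C (T (-1)) * T (-1)) * scaleInv Q := by
  simp only [evenNumerator, map_mul, map_sub, map_one, invert_T, invert_C, invert_scale,
    map_intCast]
  congr 3; ring

/-- The recursion for an even length, applied to `X^{-e'/2} Q(X)`, with `e = 2 * h`. The powers of
`Y^{1/2}` in the coefficient and in the substitution cancel, and the two summands of `𝓕` are
exchanged by `X ↦ X⁻¹`. -/
theorem coefC_step (e' : ℕ) (h ξ : ℤ) (P Q : CoefRing[T;T⁻¹])
    (hP : (T (-1) - T 1) * P = evenNumerator h ξ Q - invert (evenNumerator h ξ Q)) :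
    coefC (2 * h) e' ξ sqrtX * substYX (sqrtX ^ (-(e' : ℤ)) * ofLaurentX Q) +
      coefC (2 * h) e' ξ sqrtX⁻¹ * substYXInv (sqrtX ^ (-(e' : ℤ)) * ofLaurentX Q) =
      ofLaurentX P := by
  have hx := sqrtX_ne_zero
  have hy := sqrtY_ne_zero
  have hd := inv_sq_sub_sq_ne_zero
  have hX : substYX sqrtX = sqrtY * sqrtX := subst_sqrtX _ _
  have hX' : substYXInv sqrtX = sqrtY * sqrtX⁻¹ := subst_sqrtX _ _
  have hP' := congrArg ofLaurentX hP
  rw [invert_evenNumerator, evenNumerator] at hP'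
  simp only [map_mul, map_sub, map_one, map_intCast, ofLaurentX_T, ofLaurentX_C_T] at hP'
  rw [map_mul, map_mul, map_zpow₀, map_zpow₀, hX, hX', substYX_ofLaurentX, substYXInv_ofLaurentX,
    coefC, coefC]
  have e1 : sqrtX ^ (2 * (-1) : ℤ) = (sqrtX ^ 2)⁻¹ := by
    rw [show (2 * (-1) : ℤ) = -(2 : ℕ) by norm_num, zpow_neg, zpow_natCast]
  have e2 : sqrtX ^ (2 * 1 : ℤ) = sqrtX ^ 2 := by
    rw [show (2 * 1 : ℤ) = (2 : ℕ) by norm_num, zpow_natCast]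
  have e3 : sqrtY ^ (2 * (-1) : ℤ) = (sqrtY ^ 2)⁻¹ := by
    rw [show (2 * (-1) : ℤ) = -(2 : ℕ) by norm_num, zpow_neg, zpow_natCast]
  rw [e1, e2, e3] at hP'
  have k1 : sqrtY ^ (e' : ℤ) * sqrtX ^ (-(2 * h - e') - 2) * (sqrtY * sqrtX) ^ (-(e' : ℤ))
      = sqrtX ^ (2 * (-h - 1)) := by
    rw [mul_zpow, show 2 * (-h - 1) = (-(2 * h - e') - 2) + -(e' : ℤ) by ring, zpow_add₀ hx,
      zpow_neg sqrtY]
    field_simp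
  have k2 : sqrtY ^ (e' : ℤ) * sqrtX⁻¹ ^ (-(2 * h - e') - 2) * (sqrtY * sqrtX⁻¹) ^ (-(e' : ℤ))
      = sqrtX ^ (2 * (h + 1)) := by
    rw [mul_zpow, show 2 * (h + 1) = -(-(2 * h - e') - 2) + -(-(e' : ℤ)) by ring, zpow_add₀ hx,
      zpow_neg sqrtY, inv_zpow', inv_zpow']
    field_simp
  have hd' : ((sqrtX⁻¹ ^ 2)⁻¹ - sqrtX⁻¹ ^ 2) = -((sqrtX ^ 2)⁻¹ - sqrtX ^ 2) := by
    rw [inv_pow, inv_inv]; ring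
  rw [hd', inv_pow]
  apply mul_left_cancel₀ hd
  rw [hP', ← k1, ← k2]
  generalize (sqrtX ^ 2)⁻¹ - sqrtX ^ 2 = d at hd
  field_simp
  ring

/-- For `u = ±1`, the quotient `P` in the recursion for an even length vanishes at `X = u Y` unless
`u ^ e' = ζ`, where `ζ` is the sign in the functional equation of `Q`. -/
theorem even_step_vanishing (e' : ℕ) (h ζ : ℤ) (u : ℤˣ) (P Q : CoefRing[T;T⁻¹])
    (hQ : T (e' : ℤ) * invert Q = (ζ : CoefRing[T;T⁻¹]) * Q)
    (hP : (T (-1) - T 1) * P = evenNumerator h u Q - invert (evenNumerator h u Q)) :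
    evalUnit (unitT ℤ * signUnit u) P * (((u ^ e' : ℤˣ) : ℤ) - ζ : ℤ) = 0 := by
  have hu : ((u : ℤ) : CoefRing) * ((u : ℤ) : CoefRing) = 1 := by
    rw [← Int.cast_mul, Int.units_coe_mul_self, Int.cast_one]
  have hTT : (T (-1) : CoefRing) * T 1 = 1 := by rw [← T_add]; rfl
  have v1 : (((unitT ℤ * signUnit u) ^ (1 : ℤ) : CoefRingˣ) : CoefRing) =
      (T 1 : CoefRing) * ((u : ℤ) : CoefRing) := by
    rw [zpow_one]; rfl
  have v2 : (((unitT ℤ * signUnit u) ^ (-1 : ℤ) : CoefRingˣ) : CoefRing) =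
      (T (-1) : CoefRing) * ((u : ℤ) : CoefRing) := by
    rw [mul_zpow, Units.val_mul, unitT_zpow, signUnit_zpow_val]
    simp
  -- The functional equation at the fixed point `u` of `X ↦ X⁻¹`.
  have h1 := congrArg (evalUnit (signUnit u)) hQ
  rw [map_mul, map_mul, evalUnit_T, evalUnit_invert, signUnit_inv, signUnit_zpow_val, map_intCast,
    zpow_natCast] at h1
  replace h1 : (((u ^ e' : ℤˣ) : ℤ) : CoefRing) * evalUnit (signUnit u) Q =
    (ζ : CoefRing) * evalUnit (signUnit u) Q := h1
  -- At `u Y` the numerator vanishes, and its image under `X ↦ X⁻¹` is a multiple of `Q(u)`.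
  have h2 := congrArg (evalUnit (unitT ℤ * signUnit u)) hP
  rw [invert_evenNumerator, evenNumerator] at h2
  simp only [map_mul, map_sub, map_one, map_intCast, evalUnit_C, evalUnit_scaleInv] at h2
  simp only [evalUnit_T, v1, v2] at h2
  rw [mul_inv, signUnit_inv, mul_inv_cancel_left] at h2
  have hne :
      (T (-1) : CoefRing) * ((u : ℤ) : CoefRing) - (T 1 : CoefRing) * ((u : ℤ) : CoefRing) ≠ 0 := by
    intro h0
    have h3 : (T (-1) : CoefRing) - T 1 = 0 := by
      linear_combination ((u : ℤ) : CoefRing) * h0 - (T (-1) - T 1) * hu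
    have := congrArg (fun p : CoefRing => p.coeff 1) h3
    simp at this
  apply mul_left_cancel₀ hne
  rw [← mul_assoc, h2, Int.cast_sub]
  generalize evalUnit (unitT ℤ * signUnit u) (scale Q) = s
  generalize (((unitT ℤ * signUnit u) ^ (-h - 1) : CoefRingˣ) : CoefRing) = w
  generalize (((unitT ℤ * signUnit u) ^ (h + 1) : CoefRingˣ) : CoefRing) = w' at *
  generalize evalUnit (signUnit u) Q = q at *
  generalize (((u ^ e' : ℤˣ) : ℤ) : CoefRing) = r at *
  generalize ((u : ℤ) : CoefRing) = v at *
  generalize (ζ : CoefRing) = z at *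
  linear_combination (-w * s * (r - z) * v * v) * hTT - w * s * (r - z) * hu
    - w' * (1 - v * T (-1) * (T (-1) * v)) * h1

/-! ### The step from even to odd length -/

/-- The recursion for an odd length with `ξ = 0`, where no denominator occurs. -/
theorem coefD_step_zero (h e ζ : ℤ) (P : CoefRing[T;T⁻¹]) :
    coefD e (2 * h) 0 sqrtX * substYX (ofLaurentX P) +
      ζ * coefD e (2 * h) 0 sqrtX⁻¹ * substYXInv (ofLaurentX P) =
      sqrtX ^ (-e) * ofLaurentX
        (C (T h) * (T h * scale P + (ζ : CoefRing[T;T⁻¹]) * T (e - h) * scaleInv P)) := by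
  have hx := sqrtX_ne_zero
  rw [substYX_ofLaurentX, substYXInv_ofLaurentX, coefD, coefD]
  simp only [map_mul, map_add, map_intCast, ofLaurentX_T, ofLaurentX_C_T]
  have k1 : sqrtX ^ (-(e - 2 * h)) = sqrtX ^ (-e) * sqrtX ^ (2 * h) := by
    rw [← zpow_add₀ hx]; congr 1; ring
  have k2 : sqrtX⁻¹ ^ (-(e - 2 * h)) = sqrtX ^ (-e) * sqrtX ^ (2 * (e - h)) := by
    rw [← zpow_add₀ hx, inv_zpow']; congr 1; ring
  rw [k1, k2]
  simp
  ring

/-- The recursion for an odd length with `ξ = u = ±1`, where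
`1 - u X⁻¹ = -u X⁻¹ (1 - u X)` gives both summands the denominator `1 - u X`. -/
theorem coefD_step_unit (h e ζ : ℤ) (u : ℤˣ) (P Q : CoefRing[T;T⁻¹])
    (hQ : (1 - ((u : ℤ) : CoefRing[T;T⁻¹]) * T 1) * Q = C (T h) * (T h * scale P -
      (ζ : CoefRing[T;T⁻¹]) * ((u : ℤ) : CoefRing[T;T⁻¹]) * T (e - h + 1) * scaleInv P)) :
    coefD e (2 * h) u sqrtX * substYX (ofLaurentX P) +
      ζ * coefD e (2 * h) u sqrtX⁻¹ * substYXInv (ofLaurentX P) =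
      sqrtX ^ (-e) * ofLaurentX Q := by
  have hx := sqrtX_ne_zero
  have hu : ((u : ℤ) : FunctionField) * ((u : ℤ) : FunctionField) = 1 := by
    rw [← Int.cast_mul, Int.units_coe_mul_self, Int.cast_one]
  have hd := one_sub_mul_sq_ne_zero u
  have hQ' := congrArg ofLaurentX hQ
  rw [substYX_ofLaurentX, substYXInv_ofLaurentX, coefD, coefD]
  simp only [map_mul, map_sub, map_one, map_intCast, ofLaurentX_T, ofLaurentX_C_T] at hQ'
  have e2 : sqrtX ^ (2 * 1 : ℤ) = sqrtX ^ 2 := by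
    rw [show (2 * 1 : ℤ) = (2 : ℕ) by norm_num, zpow_natCast]
  rw [e2] at hQ'
  have k1 : sqrtX ^ (-(e - 2 * h)) = sqrtX ^ (-e) * sqrtX ^ (2 * h) := by
    rw [← zpow_add₀ hx]; congr 1; ring
  have k2 : sqrtX⁻¹ ^ (-(e - 2 * h)) * sqrtX ^ 2 = sqrtX ^ (-e) * sqrtX ^ (2 * (e - h + 1)) := by
    rw [← zpow_add₀ hx, inv_zpow', ← e2, ← zpow_add₀ hx]; congr 1; ring
  have k3 : (1 - ((u : ℤ) : FunctionField) * sqrtX⁻¹ ^ 2)⁻¹ =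
      -((u : ℤ) : FunctionField) * sqrtX ^ 2 * (1 - ((u : ℤ) : FunctionField) * sqrtX ^ 2)⁻¹ := by
    apply inv_eq_of_mul_eq_one_left
    field_simp
    linear_combination hu
  rw [div_eq_mul_inv _ (1 - ((u : ℤ) : FunctionField) * sqrtX⁻¹ ^ 2), k3, k1]
  apply mul_left_cancel₀ hd
  rw [mul_left_comm _ (sqrtX ^ (-e)) (ofLaurentX Q), hQ']
  generalize 1 - ((u : ℤ) : FunctionField) * sqrtX ^ 2 = d at *
  generalize sqrtX⁻¹ ^ (-(e - 2 * h)) = w at *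
  field_simp
  linear_combination
    (-(ζ : FunctionField) * sqrtY ^ (2 * h) * ofLaurentX (scaleInv P) * (u : ℤ)) * k2

/-- The numerator in the recursion for an odd length is divisible by `1 - u X`, since its value at
`X = u` is a multiple of `P(u Y) (u ^ h - ζ u ^ (e - h))`. -/
theorem odd_step_dvd (h e ζ : ℤ) (u : ℤˣ) (P : CoefRing[T;T⁻¹])
    (hP : evalUnit (unitT ℤ * signUnit u) P *
      (((u ^ h : ℤˣ) : ℤ) - ζ * ((u ^ (e - h) : ℤˣ) : ℤ) : ℤ) = 0) :
    ∃ Q : CoefRing[T;T⁻¹],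
      (1 - ((u : ℤ) : CoefRing[T;T⁻¹]) * T 1) * Q = C (T h) * (T h * scale P -
        (ζ : CoefRing[T;T⁻¹]) * ((u : ℤ) : CoefRing[T;T⁻¹]) * T (e - h + 1) * scaleInv P) := by
  have hu : ((u : ℤ) : CoefRing) * ((u : ℤ) : CoefRing) = 1 := by
    rw [← Int.cast_mul, Int.units_coe_mul_self, Int.cast_one]
  have hu' : ((u : ℤ) : CoefRing[T;T⁻¹]) * ((u : ℤ) : CoefRing[T;T⁻¹]) = 1 := by
    rw [← Int.cast_mul, Int.units_coe_mul_self, Int.cast_one]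
  set N : CoefRing[T;T⁻¹] := C (T h) * (T h * scale P -
        (ζ : CoefRing[T;T⁻¹]) * ((u : ℤ) : CoefRing[T;T⁻¹]) * T (e - h + 1) * scaleInv P) with hN
  have h0 : evalUnit (signUnit u) N = 0 := by
    simp only [hN, map_mul, map_sub, map_intCast, evalUnit_C, evalUnit_scale, evalUnit_scaleInv,
      signUnit_inv, evalUnit_T, signUnit_zpow_val]
    rw [zpow_add, zpow_one, Units.val_mul, Int.cast_mul]
    push_cast at hP
    linear_combination T h * hP - (T h * ζ * (((u ^ (e - h) : ℤˣ) : ℤ) : CoefRing) *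
      evalUnit (unitT ℤ * signUnit u) P) * hu
  obtain ⟨S, hS⟩ := T_sub_C_dvd (signUnit u) N
  have hc : C ((signUnit u : CoefRingˣ) : CoefRing) = ((u : ℤ) : CoefRing[T;T⁻¹]) := by
    simp [signUnit]
  rw [h0, map_zero, sub_zero, hc] at hS
  refine ⟨-((u : ℤ) : CoefRing[T;T⁻¹]) * S, ?_⟩
  rw [hS]
  linear_combination T 1 * S * hu'

/-- The functional equation at odd length, for `ξ = 0`. -/
theorem odd_step_symm_zero (h e ζ : ℤ) (hζ : ζ * ζ = 1) (P : CoefRing[T;T⁻¹]) :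
    T e * invert (C (T h) * (T h * scale P + (ζ : CoefRing[T;T⁻¹]) * T (e - h) * scaleInv P)) =
      (ζ : CoefRing[T;T⁻¹]) *
        (C (T h) * (T h * scale P + (ζ : CoefRing[T;T⁻¹]) * T (e - h) * scaleInv P)) := by
  have hζ' : (ζ : CoefRing[T;T⁻¹]) * ζ = 1 := by rw [← Int.cast_mul, hζ, Int.cast_one]
  simp only [map_mul, map_add, invert_C, invert_T, map_intCast, invert_scale, invert_scaleInv]
  have k1 : (T (e - h) : CoefRing[T;T⁻¹]) = T e * T (-h) := by rw [← T_add]; rfl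
  have k2 : (T e * T (-(e - h)) : CoefRing[T;T⁻¹]) = T h := by rw [← T_add]; congr 1; ring
  linear_combination (C (T h) * ζ * scale P) * k2 - (C (T h) * scaleInv P) * k1 -
    (C (T h) * T (e - h) * scaleInv P) * hζ'

/-- The functional equation at odd length, for `ξ = u = ±1`. -/
theorem odd_step_symm_unit (h e ζ : ℤ) (hζ : ζ * ζ = 1) (u : ℤˣ) (P Q : CoefRing[T;T⁻¹])
    (hQ : (1 - ((u : ℤ) : CoefRing[T;T⁻¹]) * T 1) * Q = C (T h) * (T h * scale P -
      (ζ : CoefRing[T;T⁻¹]) * ((u : ℤ) : CoefRing[T;T⁻¹]) * T (e - h + 1) * scaleInv P)) :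
    T e * invert Q = (ζ : CoefRing[T;T⁻¹]) * Q := by
  have hζ' : (ζ : CoefRing[T;T⁻¹]) * ζ = 1 := by rw [← Int.cast_mul, hζ, Int.cast_one]
  have hu : ((u : ℤ) : CoefRing[T;T⁻¹]) * ((u : ℤ) : CoefRing[T;T⁻¹]) = 1 := by
    rw [← Int.cast_mul, Int.units_coe_mul_self, Int.cast_one]
  have hi := congrArg (invert : CoefRing[T;T⁻¹] ≃ₐ[CoefRing] _) hQ
  simp only [map_mul, map_sub, map_one, invert_C, invert_T, map_intCast, invert_scale,
    invert_scaleInv] at hi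
  have hTT : (T (-1) : CoefRing[T;T⁻¹]) * T 1 = 1 := by rw [← T_add]; rfl
  have k1 : (T (e - h + 1) : CoefRing[T;T⁻¹]) = T e * T (-h) * T 1 := by
    rw [← T_add, ← T_add]; rfl
  have k2 : (T e * T 1 * T (-(e - h + 1)) : CoefRing[T;T⁻¹]) = T h := by
    rw [← T_add, ← T_add]; congr 1; ring
  apply mul_left_cancel₀ (one_sub_mul_T_ne_zero u)
  generalize ((u : ℤ) : CoefRing[T;T⁻¹]) = v at *
  generalize (ζ : CoefRing[T;T⁻¹]) = z at *
  generalize invert Q = Q' at *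
  linear_combination (T e * (-v * T 1)) * hi - z * hQ - (T e * Q' * v * v) * hTT
    - (T e * Q') * hu + (C (T h) * scaleInv P * v) * k1
    + (C (T h) * scaleInv P * v * T (e - h + 1)) * hζ' + (C (T h) * scale P * z * v * v) * k2
    + (C (T h) * scale P * z * T h) * hu

/-! ### Truncation of a naive EGK datum and the recursion for `𝓕` -/

theorem IsNaiveEGK.init {n : ℕ} {a : Fin (n + 1) → ℕ} {ε : Fin (n + 1) → SignType}
    (hH : IsNaiveEGK a ε) :
    IsNaiveEGK (Fin.init a : Fin n → ℕ) (Fin.init ε : Fin n → SignType) := by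
  have hs (i : Fin n) : ∑ j ∈ Finset.Iic i, (Fin.init a : Fin n → ℕ) j =
      ∑ j ∈ Finset.Iic i.castSucc, a j := by
    rw [← Fin.map_castSuccEmb_Iic, Finset.sum_map]
    rfl
  refine ⟨fun i j hij => hH.mono (Fin.castSucc_le_castSucc_iff.mpr hij), fun i hi => ?_,
    fun i hi => hH.odd_pos i.castSucc hi, fun h => hH.first (Nat.succ_pos n), fun k h hk he => ?_⟩
  · rw [hs]
    exact hH.even_pos i.castSucc hi
  · rw [hs] at he
    exact hH.odd_step k (by omega) hk he

theorem sum_Iic_castSucc_last {n : ℕ} (a : Fin (n + 2) → ℕ) :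
    ∑ j ∈ Finset.Iic (Fin.last n).castSucc, a j = ∑ j, (Fin.init a : Fin (n + 1) → ℕ) j := by
  rw [← Fin.map_castSuccEmb_Iic, Finset.sum_map, ← Fin.top_eq_last, Finset.Iic_top]
  rfl

theorem sum_eq_sum_init_add {n : ℕ} (a : Fin (n + 1) → ℕ) :
    ∑ j, a j = ∑ j, (Fin.init a : Fin n → ℕ) j + a (Fin.last n) :=
  Fin.sum_univ_castSucc a

theorem calF_of_even {m : ℕ} (hm : Even (m + 2)) (a : Fin (m + 2) → ℕ)
    (ε : Fin (m + 2) → SignType) :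
    calF (m + 2) a ε =
      coefC (frakE a) (frakE (Fin.init a : Fin (m + 1) → ℕ)) (ε (Fin.last (m + 1)) : ℤ) sqrtX *
        substYX (calF (m + 1) (Fin.init a) (Fin.init ε)) +
      coefC (frakE a) (frakE (Fin.init a : Fin (m + 1) → ℕ)) (ε (Fin.last (m + 1)) : ℤ) sqrtX⁻¹ *
        substYXInv (calF (m + 1) (Fin.init a) (Fin.init ε)) := by
  rw [calF]
  simp only [coef, if_pos hm, Int.cast_one, one_mul]

theorem calF_of_not_even {m : ℕ} (hm : ¬ Even (m + 2)) (a : Fin (m + 2) → ℕ)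
    (ε : Fin (m + 2) → SignType) :
    calF (m + 2) a ε =
      coefD (frakE a) (frakE (Fin.init a : Fin (m + 1) → ℕ)) (ε (Fin.last m).castSucc : ℤ) sqrtX *
        substYX (calF (m + 1) (Fin.init a) (Fin.init ε)) +
      ((ε (Fin.last (m + 1)) : ℤ) : FunctionField) *
        coefD (frakE a) (frakE (Fin.init a : Fin (m + 1) → ℕ)) (ε (Fin.last m).castSucc : ℤ)
          sqrtX⁻¹ *
        substYXInv (calF (m + 1) (Fin.init a) (Fin.init ε)) := by
  rw [calF]
  simp only [coef, if_neg hm]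
  rfl

/-! ### The induction on the length -/

/-- What holds at odd length, with `e = a_1 + ⋯ + a_n`: `𝓕 = X^{-e/2} Q(X)` for a Laurent polynomial
`Q` with `X^e Q(X⁻¹) = ε_n Q(X)`, that is, `𝓕(H; Y, X⁻¹) = ε_n 𝓕(H; Y, X)`. -/
def OddShape {m : ℕ} (a : Fin (m + 1) → ℕ) (ε : Fin (m + 1) → SignType) : Prop :=
  ∃ Q : CoefRing[T;T⁻¹],
    calF (m + 1) a ε = sqrtX ^ (-((∑ j, a j : ℕ) : ℤ)) * ofLaurentX Q ∧
    T ((∑ j, a j : ℕ) : ℤ) * invert Q = ((ε (Fin.last m) : ℤ) : CoefRing[T;T⁻¹]) * Q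

/-- What holds at even length: `𝓕 = P(X)` for a Laurent polynomial `P` which, if `ξ = ε_n ≠ 0`,
vanishes at `X = ξ Y` unless `ξ ^ (a_1 + ⋯ + a_{n-1}) = ε_{n-1}`. -/
def EvenShape {m : ℕ} (a : Fin (m + 2) → ℕ) (ε : Fin (m + 2) → SignType) : Prop :=
  ∃ P : CoefRing[T;T⁻¹],
    calF (m + 2) a ε = ofLaurentX P ∧
    ∀ u : ℤˣ, (ε (Fin.last (m + 1)) : ℤ) = u →
      evalUnit (unitT ℤ * signUnit u) P *
        (((u ^ (∑ j, (Fin.init a : Fin (m + 1) → ℕ) j) : ℤˣ) : ℤ) -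
          (ε (Fin.last m).castSucc : ℤ) : ℤ) = 0

theorem oddShape_one (a : Fin 1 → ℕ) (ε : Fin 1 → SignType) (hε : ε 0 = 1) : OddShape a ε := by
  have hs : ∑ j : Fin (0 + 1), a j = a 0 := Fin.sum_univ_one a
  refine ⟨∑ k ∈ Finset.range (a 0 + 1), T (k : ℤ), ?_, ?_⟩
  · simp only [calF, map_sum, ofLaurentX_T, Finset.mul_sum, hs]
    refine Finset.sum_congr rfl fun k _ => ?_
    rw [← zpow_add₀ sqrtX_ne_zero]
    congr 1
    ring
  · have h1 : ((ε (Fin.last 0) : ℤ) : CoefRing[T;T⁻¹]) = 1 := by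
      rw [show Fin.last 0 = 0 from rfl, hε]; simp
    simp only [h1, one_mul, map_sum, invert_T, Finset.mul_sum, hs]
    rw [← Finset.sum_range_reflect]
    refine Finset.sum_congr rfl fun k hk => ?_
    rw [← T_add]
    congr 1
    have := Finset.mem_range.mp hk
    omega

theorem OddShape.evenShape {m : ℕ} (hm : Even m) (a : Fin (m + 2) → ℕ)
    (ε : Fin (m + 2) → SignType)
    (hO : OddShape (Fin.init a : Fin (m + 1) → ℕ) (Fin.init ε : Fin (m + 1) → SignType)) :
    EvenShape a ε := by
  obtain ⟨Q, hF, hQ⟩ := hO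
  have he : Even (m + 2) := hm.add even_two
  obtain ⟨P, hP⟩ := dvd_sub_invert
    (evenNumerator (((∑ j, a j) / 2 : ℕ) : ℤ) (ε (Fin.last (m + 1)) : ℤ) Q)
  refine ⟨P, ?_, fun u hu => ?_⟩
  · rw [← coefC_step _ _ _ P Q hP.symm, ← hF]
    have h1 : frakE a = 2 * ((∑ j, a j) / 2) := if_neg (Nat.not_odd_iff_even.mpr he)
    have h2 : frakE (Fin.init a : Fin (m + 1) → ℕ) = ∑ j, (Fin.init a : Fin (m + 1) → ℕ) j :=
      if_pos hm.add_one
    rw [calF_of_even he, h1, h2, Nat.cast_mul, Nat.cast_two]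
  · rw [hu] at hP
    exact even_step_vanishing _ _ _ u P Q hQ hP.symm

theorem EvenShape.oddShape {m : ℕ} (hm : Even m) (a : Fin (m + 3) → ℕ)
    (ε : Fin (m + 3) → SignType) (hH : IsNaiveEGK a ε)
    (hE : EvenShape (Fin.init a : Fin (m + 2) → ℕ) (Fin.init ε : Fin (m + 2) → SignType)) :
    OddShape a ε := by
  obtain ⟨P, hF, hP⟩ := hE
  have ho : ¬ Even (m + 1 + 2) := by grind
  have he : ¬ Odd (m + 2) := by grind
  set h : ℕ := (∑ j, (Fin.init a : Fin (m + 2) → ℕ) j) / 2 with hh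
  have h1 : frakE a = ∑ j, a j := if_pos (by grind)
  have h2 : frakE (Fin.init a : Fin (m + 2) → ℕ) = 2 * h := if_neg he
  set ζ : ℤ := (ε (Fin.last (m + 2)) : ℤ) with hζ
  have hζζ : ζ * ζ = 1 := by
    have h0 := hH.odd_pos (Fin.last (m + 2)) (by simpa using hm.add even_two)
    rcases SignType.trichotomy (ε (Fin.last (m + 2))) with h | h | h
    · simp [hζ, h]
    · exact absurd h h0
    · simp [hζ, h]
  set ξ : SignType := ε (Fin.last (m + 1)).castSucc with hξ
  have hrec : calF (m + 1 + 2) a ε =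
      coefD ((∑ j, a j : ℕ) : ℤ) (2 * (h : ℤ)) (ξ : ℤ) sqrtX * substYX (ofLaurentX P) +
      ζ * coefD ((∑ j, a j : ℕ) : ℤ) (2 * (h : ℤ)) (ξ : ℤ) sqrtX⁻¹ *
        substYXInv (ofLaurentX P) := by
    rw [calF_of_not_even ho, hF, h1, h2, Nat.cast_mul, Nat.cast_two]
  by_cases h0 : ξ = 0
  · rw [h0, SignType.coe_zero, coefD_step_zero] at hrec
    exact ⟨_, hrec, odd_step_symm_zero _ _ ζ hζζ P⟩
  obtain ⟨u, hu⟩ : ∃ u : ℤˣ, (ξ : ℤ) = u := by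
    rcases SignType.trichotomy ξ with h | h | h
    · exact ⟨-1, by simp [h]⟩
    · exact absurd h h0
    · exact ⟨1, by simp [h]⟩
  have hev : Even (∑ j, (Fin.init a : Fin (m + 2) → ℕ) j) := by
    rw [← sum_Iic_castSucc_last]
    exact (hH.even_pos (Fin.last (m + 1)).castSucc (by simpa using hm.add_one)).mp h0
  have hstep : ε (Fin.last (m + 2)) =
      ξ ^ (a (Fin.last (m + 2)) + a (Fin.last (m + 1)).castSucc) *
        ε (Fin.last m).castSucc.castSucc := by
    refine hH.odd_step m (by omega) hm ?_
    have := sum_Iic_castSucc_last a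
    exact this ▸ hev
  set δ : ℤ := (ε (Fin.last m).castSucc.castSucc : ℤ) with hδ
  have hζu : ζ = ((u ^ (a (Fin.last (m + 2)) + a (Fin.last (m + 1)).castSucc) : ℤˣ) : ℤ) * δ := by
    rw [hζ, hstep, SignType.coe_mul, SignType.coe_pow, hu, Units.val_pow_eq_pow_val]
  have hPu := hP u hu
  set e'' : ℕ := ∑ j, (Fin.init (Fin.init a : Fin (m + 2) → ℕ) : Fin (m + 1) → ℕ) j with he''
  have hs1 : ∑ j, a j = 2 * h + a (Fin.last (m + 2)) := by
    rw [sum_eq_sum_init_add]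
    grind
  have hs2 : 2 * h = e'' + a (Fin.last (m + 1)).castSucc := by
    have : ∑ j, (Fin.init a : Fin (m + 2) → ℕ) j = e'' + a (Fin.last (m + 1)).castSucc :=
      sum_eq_sum_init_add _
    grind
  -- The relation (N5), with `ε_n` eliminated and the exponents reduced modulo two.
  have key : ((u ^ (h : ℤ) : ℤˣ) : ℤ) -
      ζ * ((u ^ (((∑ j, a j : ℕ) : ℤ) - h) : ℤˣ) : ℤ) =
      ((u ^ (h + e'') : ℤˣ) : ℤ) * (((u ^ e'' : ℤˣ) : ℤ) - δ) := by
    rw [hζu, hs1, show ((2 * h + a (Fin.last (m + 2)) : ℕ) : ℤ) - h =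
      ((h + a (Fin.last (m + 2)) : ℕ) : ℤ) by push_cast; ring, zpow_natCast, zpow_natCast]
    rcases Int.units_eq_one_or u with rfl | rfl
    · simp
    · have p1 : ((-1 : ℤ) ^ e'') * (-1) ^ e'' = 1 := by
        rw [← mul_pow]; simp
      have p2 : ((-1 : ℤ) ^ a (Fin.last (m + 2))) * (-1) ^ a (Fin.last (m + 2)) = 1 := by
        rw [← mul_pow]; simp
      have p3 : ((-1 : ℤ) ^ e'') * (-1) ^ a (Fin.last (m + 1)).castSucc = 1 := by
        rw [← pow_add, ← hs2, pow_mul]; simp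
      have p4 : (-1 : ℤ) ^ a (Fin.last (m + 1)).castSucc = (-1) ^ e'' := by
        linear_combination (-1 : ℤ) ^ e'' * p3 - (-1) ^ a (Fin.last (m + 1)).castSucc * p1
      push_cast
      simp only [pow_add, p4]
      linear_combination (-(-1) ^ h) * p1 - ((-1) ^ e'' * δ * (-1) ^ h) * p2
  obtain ⟨Q, hQ⟩ := odd_step_dvd (h : ℤ) ((∑ j, a j : ℕ) : ℤ) ζ u P (by
    rw [key, Int.cast_mul, mul_left_comm]
    exact mul_eq_zero_of_right _ hPu)
  refine ⟨Q, ?_, odd_step_symm_unit _ _ ζ hζζ u P Q hQ⟩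
  rw [hrec, hu, coefD_step_unit _ _ ζ u P Q hQ]

theorem oddShape_of_isNaiveEGK (k : ℕ) : ∀ (a : Fin (2 * k + 1) → ℕ)
    (ε : Fin (2 * k + 1) → SignType), IsNaiveEGK a ε → OddShape a ε := by
  induction k with
  | zero => exact fun a ε hH => oddShape_one a ε (hH.first one_pos)
  | succ k ih =>
    intro a ε hH
    exact EvenShape.oddShape (even_two_mul k) a ε hH
      (OddShape.evenShape (even_two_mul k) _ _ (ih _ _ hH.init.init))

/-- Multiplying by a power of `X^{1/2}` keeps the image of `ofLaurentX` within that of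
`ofLaurent`. -/
theorem ofLaurentX_mem_range (p : ℤ) (Q : CoefRing[T;T⁻¹]) :
    ∃ P, sqrtX ^ p * ofLaurentX Q = ofLaurent P := by
  refine ⟨T p * substUnit (unitT _ ^ 2) Q, ?_⟩
  rw [map_mul]
  simp [ofLaurent, ofLaurentX]

end NaiveEGK

theorem proposition4p2 (n : ℕ) (hn : 1 ≤ n) (a : Fin n → ℕ) (ε : Fin n → SignType)
    (hH : NaiveEGK.IsNaiveEGK a ε) :
    ∃ P : LaurentPolynomial (LaurentPolynomial ℤ),
      NaiveEGK.calF n a ε = NaiveEGK.ofLaurent P := by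
  obtain ⟨k, rfl | rfl⟩ : ∃ k, n = 2 * k + 1 ∨ n = 2 * k + 2 := ⟨(n - 1) / 2, by omega⟩
  · obtain ⟨Q, hQ, -⟩ := NaiveEGK.oddShape_of_isNaiveEGK k a ε hH
    rw [hQ]
    exact NaiveEGK.ofLaurentX_mem_range _ Q
  · obtain ⟨P, hP, -⟩ := (NaiveEGK.oddShape_of_isNaiveEGK k _ _ hH.init).evenShape
      (even_two_mul k) a ε
    rw [hP, ← one_mul (NaiveEGK.ofLaurentX P), ← zpow_zero NaiveEGK.sqrtX]
    exact NaiveEGK.ofLaurentX_mem_range 0 P
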